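/- **Convergence of the alternating fixed-point algorithm for density bands.** Let $\mu$ be a measure on a measurable space $\Omega$. For $i=0,1$ let a density band be given by measurable functions $p_i':\Omega\to[0,\infty)$ and $p_i'':\Omega\to[0,\infty]$ with $p_i'\le p_i''$ and $\int p_i'\,d\mu\le 1\le\int p_i''\,d\mu$, and let $\mathcal P_i$ be the set of probability densities $q$ with respect to $\mu$ such that $p_i'\le q\le p_i''$ $\mu$-a.e. Let $\alpha\ge 0$. Let $q_i^0\in\mathcal P_i$ be arbitrary, and suppose that for all $n\ge1$, $\mu$-a.e., $$q_0^n=\min\{p_0'',\max\{c_0^n(\alpha q_0^{n-1}+q_1^{n-1}),p_0'\}\},\qquad q_1^n=\min\{p_1'',\max\{c_1^n(q_0^{n}+\alpha q_1^{n-1}),p_1'\}\},$$ where $c_0^n,c_1^n>0$ are chosen such that both right-hand sides integrate to $1$ (that is, the iteration can be carried out; any such choice of constants is allowed). Write $\|\cdot\|$ for the norm of $L^1(\mu)$. Then: 1. $\|q_i^n-q_i^{n-1}\|\to0$ as $n\to\infty$, for $i=0,1$. 2. The iterates asymptotically satisfy the implicit equations of the least favorable densities: there are constants $d_0^n,d_1^n>0$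 with $\alpha d_i^n\le1$ (i.e. $d_i^n\in(0,1/\alpha]$) such that $$\bigl\|q_0^n-\min\{p_0'',\max\{d_0^n(\alpha q_0^{n}+q_1^{n}),p_0'\}\}\bigr\|\to0,\qquad \bigl\|q_1^n-\min\{p_1'',\max\{d_1^n(q_0^{n}+\alpha q_1^{n}),p_1'\}\}\bigr\|\to0 .$$ 3. Every limit point of the iterates is a solution: if $q_0^{n_k}\to q_0$ and $q_1^{n_k}\to q_1$ in $L^1(\mu)$ along a common subsequence, then $q_0\in\mathcal P_0$, $q_1\in\mathcal P_1$, and there are constants $c_0,c_1\ge0$ with $\alpha c_i\le1$, and $c_i>0$ whenever $\int p_i'\,d\mu<1$, such that $\mu$-a.e. $$q_0=\min\{p_0'',\max\{c_0(\alpha q_0+q_1),p_0'\}\},\qquad q_1=\min\{p_1'',\max\{c_1(q_0+\alpha q_1),p_1'\}\}.$$ -/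

import Mathlib

open MeasureTheory Filter Topology
open scoped NNReal ENNReal

/-- A density band `p' ≤ p ≤ p''` with respect to `μ`: `lower` is `p'`, `upper` is `p''`
(the upper bound may take the value `∞` and need not be integrable), and
`P'(Ω) ≤ 1 ≤ P''(Ω)`. -/
structure DensityBand {Ω : Type*} [MeasurableSpace Ω] (μ : Measure Ω) where
  lower : Ω → ℝ≥0
  upper : Ω → ℝ≥0∞
  measurable_lower : Measurable lower
  measurable_upper : Measurable upper
  lower_le_upper : ∀ ω, (lower ω : ℝ≥0∞) ≤ upper ω
  lintegral_lower_le : ∫⁻ ω, (lower ω : ℝ≥0∞) ∂μ ≤ 1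
  one_le_lintegral_upper : 1 ≤ ∫⁻ ω, upper ω ∂μ

namespace DensityBand

variable {Ω : Type*} [MeasurableSpace Ω] {μ : Measure Ω}

/-- `q` is the `μ`-density of a probability measure that belongs to the band. -/
structure Mem (B : DensityBand μ) (q : Ω → ℝ≥0) : Prop where
  aemeasurable : AEMeasurable q μ
  lintegral_eq_one : ∫⁻ ω, (q ω : ℝ≥0∞) ∂μ = 1
  lower_le : ∀ᵐ ω ∂μ, B.lower ω ≤ q ω
  le_upper : ∀ᵐ ω ∂μ, (q ω : ℝ≥0∞) ≤ B.upper ω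

/-- The function `min {p'', max {c p, p'}}`. -/
noncomputable def clip (B : DensityBand μ) (c : ℝ≥0) (p : Ω → ℝ≥0) (ω : Ω) : ℝ≥0 :=
  (min (B.upper ω) ((max (c * p ω) (B.lower ω) : ℝ≥0) : ℝ≥0∞)).toNNReal

/-- The minimum in `clip` is finite, so that passing to `ℝ≥0` changes nothing. -/
theorem coe_clip (B : DensityBand μ) (c : ℝ≥0) (p : Ω → ℝ≥0) (ω : Ω) :
    (B.clip c p ω : ℝ≥0∞) =
      min (B.upper ω) ((max (c * p ω) (B.lower ω) : ℝ≥0) : ℝ≥0∞) :=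
  ENNReal.coe_toNNReal (ne_top_of_le_ne_top ENNReal.coe_ne_top (min_le_right _ _))

/-- The function `g(c ; p) = ∫ min {p'', max {c p, p'}} dμ - 1`. -/
noncomputable def g (B : DensityBand μ) (c : ℝ≥0) (p : Ω → ℝ≥0) : ℝ :=
  (∫⁻ ω, (B.clip c p ω : ℝ≥0∞) ∂μ).toReal - 1

end DensityBand

/-- The implicit equations
`q₀ = min {p₀'', max {c₀ (α q₀ + q₁), p₀'}}` and `q₁ = min {p₁'', max {c₁ (q₀ + α q₁), p₁'}}`,
as equations between densities, that is, `μ`-almost everywhere. -/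
def SolvesImplicitEquations {Ω : Type*} [MeasurableSpace Ω] {μ : Measure Ω}
    (B₀ B₁ : DensityBand μ) (α c₀ c₁ : ℝ≥0) (q₀ q₁ : Ω → ℝ≥0) : Prop :=
  q₀ =ᵐ[μ] B₀.clip c₀ (fun ω => α * q₀ ω + q₁ ω) ∧
  q₁ =ᵐ[μ] B₁.clip c₁ (fun ω => q₀ ω + α * q₁ ω)

/-- `(q₀ n, q₁ n)` are the iterates of the alternating fixed-point algorithm, where `c₀ n` and
`c₁ n` are the roots that are computed in the pass from the `n`-th to the `(n+1)`-th iterate. -/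
structure IsAlgorithmRun {Ω : Type*} [MeasurableSpace Ω] {μ : Measure Ω}
    (B₀ B₁ : DensityBand μ) (α : ℝ≥0) (q₀ q₁ : ℕ → Ω → ℝ≥0) (c₀ c₁ : ℕ → ℝ≥0) : Prop where
  init₀ : B₀.Mem (q₀ 0)
  init₁ : B₁.Mem (q₁ 0)
  pos₀ : ∀ n, 0 < c₀ n
  root₀ : ∀ n, B₀.g (c₀ n) (fun ω => α * q₀ n ω + q₁ n ω) = 0
  step₀ : ∀ n, q₀ (n + 1) =ᵐ[μ] B₀.clip (c₀ n) (fun ω => α * q₀ n ω + q₁ n ω)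
  pos₁ : ∀ n, 0 < c₁ n
  root₁ : ∀ n, B₁.g (c₁ n) (fun ω => q₀ (n + 1) ω + α * q₁ n ω) = 0
  step₁ : ∀ n, q₁ (n + 1) =ᵐ[μ] B₁.clip (c₁ n) (fun ω => q₀ (n + 1) ω + α * q₁ n ω)

/-- The distance `‖p - q‖` in `L¹(μ)`, i.e. the total variation distance `∫ |p - q| dμ`. -/
noncomputable def l1Dist {Ω : Type*} [MeasurableSpace Ω] (μ : Measure Ω) (p q : Ω → ℝ≥0) :
    ℝ≥0∞ :=
  eLpNorm (fun ω => (p ω : ℝ) - (q ω : ℝ)) 1 μ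

/-! ### Order and Lipschitz properties of clipping. -/

namespace DensityBand

variable {Ω : Type*} [MeasurableSpace Ω] {μ : Measure Ω}

/-! The potentials `∫ max (q₀, t q₁)`, one for each `t ≥ 0`, decrease at every half-step, and their
decrease controls the step length. Let `q = clip d (α q' + r)` with `α d < 1`, and put `s = d / (1 -
α d)`. Where `q < q'`, the clip is not cut from above, so `q ≥ d (α q' + r) ≥ α d q + d r`, that is
`q ≥ s r`; where `q > q'`, likewise `q ≤ s r`. Thus `q'` moves towards `s r` without crossing it.
Hence no potential increases (`IsClipStep.lintegral_max_le`), and the one at `t = s` drops by at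
least `∫ (q' - q)⁺`, half the `L¹` step; `t` slightly above `s` costs only `t - s`
(`IsClipStep.lintegral_tsub_add_le`). Each potential converges, but `s` depends on `n`. Once the
roots are bounded (`exists_bound`), either `α d` is near one and the step is small anyway, or `s`
stays in a compact interval covered by a finite grid of `t`. So steps tend to zero; the asymptotic
equations and the limit equations follow from continuity of clipping and compactness of the bounded
roots. -/

theorem lower_le_clip (B : DensityBand μ) (c : ℝ≥0) (p : Ω → ℝ≥0) (ω : Ω) :
    B.lower ω ≤ B.clip c p ω := by
  rw [← ENNReal.coe_le_coe, coe_clip]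
  exact le_min (B.lower_le_upper ω) (ENNReal.coe_le_coe.2 (le_max_right _ _))

theorem clip_le_upper (B : DensityBand μ) (c : ℝ≥0) (p : Ω → ℝ≥0) (ω : Ω) :
    (B.clip c p ω : ℝ≥0∞) ≤ B.upper ω := by
  rw [coe_clip]
  exact min_le_left _ _

theorem clip_le_max (B : DensityBand μ) (c : ℝ≥0) (p : Ω → ℝ≥0) (ω : Ω) :
    B.clip c p ω ≤ max (c * p ω) (B.lower ω) := by
  rw [← ENNReal.coe_le_coe, coe_clip]
  exact min_le_right _ _

theorem le_clip {B : DensityBand μ} {c : ℝ≥0} {p : Ω → ℝ≥0} {ω : Ω} {x : ℝ≥0}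
    (h₁ : (x : ℝ≥0∞) ≤ B.upper ω) (h₂ : x ≤ max (c * p ω) (B.lower ω)) :
    x ≤ B.clip c p ω := by
  rw [← ENNReal.coe_le_coe, coe_clip]
  exact le_min h₁ (ENNReal.coe_le_coe.2 h₂)

theorem clip_mono (B : DensityBand μ) {c d : ℝ≥0} {p r : Ω → ℝ≥0} {ω : Ω}
    (h : c * p ω ≤ d * r ω) : B.clip c p ω ≤ B.clip d r ω :=
  le_clip (B.clip_le_upper c p ω) ((B.clip_le_max c p ω).trans (max_le_max_right _ h))

theorem clip_zero (B : DensityBand μ) (p : Ω → ℝ≥0) (ω : Ω) : B.clip 0 p ω = B.lower ω :=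
  le_antisymm ((B.clip_le_max 0 p ω).trans (by simp)) (B.lower_le_clip 0 p ω)

/-- Below an admissible value, the clipped function is not cut by the upper bound. -/
theorem mul_le_clip_of_lt {B : DensityBand μ} {c : ℝ≥0} {p : Ω → ℝ≥0} {ω : Ω} {x : ℝ≥0}
    (hx : (x : ℝ≥0∞) ≤ B.upper ω) (h : B.clip c p ω < x) : c * p ω ≤ B.clip c p ω := by
  by_contra! hc
  refine (lt_min hc h).not_ge (le_clip ?_ ((min_le_left _ _).trans (le_max_left _ _)))
  exact (ENNReal.coe_le_coe.2 (min_le_right _ _)).trans hx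

/-- Above an admissible value, the clipped function is not cut by the lower bound. -/
theorem clip_le_mul_of_lt {B : DensityBand μ} {c : ℝ≥0} {p : Ω → ℝ≥0} {ω : Ω} {x : ℝ≥0}
    (hx : B.lower ω ≤ x) (h : x < B.clip c p ω) : B.clip c p ω ≤ c * p ω := by
  rcases le_max_iff.1 (B.clip_le_max c p ω) with h' | h'
  · exact h'
  · exact absurd (h'.trans hx) h.not_ge

/-- Clipping is 1-Lipschitz, in one-sided form: used in both directions it bounds the absolute
difference. -/
theorem clip_tsub_clip_le (B : DensityBand μ) (c d : ℝ≥0) (p r : Ω → ℝ≥0) (ω : Ω) :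
    B.clip c p ω - B.clip d r ω ≤ c * p ω - d * r ω := by
  rcases le_or_gt (B.clip c p ω) (B.clip d r ω) with h | h
  · simp [tsub_eq_zero_of_le h]
  · exact tsub_le_tsub (clip_le_mul_of_lt (B.lower_le_clip d r ω) h)
      (mul_le_clip_of_lt (B.clip_le_upper c p ω) h)

theorem aemeasurable_clip (B : DensityBand μ) (c : ℝ≥0) {p : Ω → ℝ≥0} (hp : AEMeasurable p μ) :
    AEMeasurable (B.clip c p) μ := by
  have h : AEMeasurable (fun ω => max (c * p ω) (B.lower ω)) μ :=
    (hp.const_mul c).max B.measurable_lower.aemeasurable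
  exact (B.measurable_upper.aemeasurable.min h.coe_nnreal_ennreal).ennreal_toNNReal

theorem tendsto_clip (B : DensityBand μ) {c : ℕ → ℝ≥0} {p : ℕ → Ω → ℝ≥0} {c' : ℝ≥0}
    {p' : Ω → ℝ≥0} {ω : Ω} (hc : Tendsto c atTop (𝓝 c'))
    (hp : Tendsto (fun k => p k ω) atTop (𝓝 (p' ω))) :
    Tendsto (fun k => B.clip (c k) (p k) ω) atTop (𝓝 (B.clip c' p' ω)) := by
  rw [← ENNReal.tendsto_coe]
  simp only [coe_clip]
  exact tendsto_const_nhds.min (ENNReal.tendsto_coe.2 ((hc.mul hp).max tendsto_const_nhds))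

theorem lintegral_clip_of_g_eq_zero {B : DensityBand μ} {c : ℝ≥0} {p : Ω → ℝ≥0}
    (h : B.g c p = 0) : ∫⁻ ω, (B.clip c p ω : ℝ≥0∞) ∂μ = 1 :=
  (ENNReal.toReal_eq_one_iff _).1 (sub_eq_zero.1 h)

theorem ae_eq_of_le_of_lintegral_eq_one {f h : Ω → ℝ≥0} (hf : ∫⁻ ω, (f ω : ℝ≥0∞) ∂μ = 1)
    (hh : AEMeasurable h μ) (hle : f ≤ᵐ[μ] h) (h1 : ∫⁻ ω, (h ω : ℝ≥0∞) ∂μ ≤ 1) : f =ᵐ[μ] h := by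
  have := ae_eq_of_ae_le_of_lintegral_le (f := fun ω => (f ω : ℝ≥0∞))
    (g := fun ω => (h ω : ℝ≥0∞)) (hle.mono fun ω hω => ENNReal.coe_le_coe.2 hω)
    (by simp [hf]) hh.coe_nnreal_ennreal (by rw [hf]; exact h1)
  exact this.mono fun ω hω => ENNReal.coe_injective hω

/-- A root may be replaced by any smaller constant whose clipped function still has mass at
least one. -/
theorem clip_min_ae_eq {B : DensityBand μ} {c M : ℝ≥0} {p : Ω → ℝ≥0} (hp : AEMeasurable p μ)
    (hc : ∫⁻ ω, (B.clip c p ω : ℝ≥0∞) ∂μ = 1) (hM : 1 ≤ ∫⁻ ω, (B.clip M p ω : ℝ≥0∞) ∂μ) :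
    B.clip c p =ᵐ[μ] B.clip (min c M) p := by
  rcases le_total c M with h | h
  · rw [min_eq_left h]
  · rw [min_eq_right h]
    have hle : ∀ ω, B.clip M p ω ≤ B.clip c p ω :=
      fun ω => B.clip_mono (mul_le_mul_left h _)
    refine (ae_eq_of_le_of_lintegral_eq_one (le_antisymm ?_ hM) (B.aemeasurable_clip c hp)
      (.of_forall hle) hc.le).symm
    exact (lintegral_mono fun ω => ENNReal.coe_le_coe.2 (hle ω)).trans hc.le

theorem mem_of_ae_eq_clip {B : DensityBand μ} {c : ℝ≥0} {p q : Ω → ℝ≥0} (hp : AEMeasurable p μ)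
    (hc : ∫⁻ ω, (B.clip c p ω : ℝ≥0∞) ∂μ = 1) (hq : q =ᵐ[μ] B.clip c p) : B.Mem q where
  aemeasurable := (B.aemeasurable_clip c hp).congr hq.symm
  lintegral_eq_one := by
    rw [← hc]
    exact lintegral_congr_ae (hq.mono fun ω hω => by simp only [hω])
  lower_le := hq.mono fun ω hω => hω ▸ B.lower_le_clip c p ω
  le_upper := hq.mono fun ω hω => hω ▸ B.clip_le_upper c p ω

end DensityBand

/-! ### The `L¹` distance and limits of densities. -/

section L1

variable {Ω : Type*} [MeasurableSpace Ω] {μ : Measure Ω}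

theorem l1Dist_eq_lintegral (p q : Ω → ℝ≥0) :
    l1Dist μ p q = ∫⁻ ω, ((p ω - q ω + (q ω - p ω) : ℝ≥0) : ℝ≥0∞) ∂μ := by
  rw [l1Dist, eLpNorm_one_eq_lintegral_enorm]
  refine lintegral_congr fun ω => ?_
  rw [enorm_eq_nnnorm, ENNReal.coe_inj, ← NNReal.coe_inj, coe_nnnorm, Real.norm_eq_abs]
  rcases le_total (p ω) (q ω) with h | h
  · rw [tsub_eq_zero_of_le h, zero_add, NNReal.coe_sub h, abs_of_nonpos (by simpa using h)]
    ring
  · rw [tsub_eq_zero_of_le h, add_zero, NNReal.coe_sub h, abs_of_nonneg (by simpa using h)]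

theorem l1Dist_comm (p q : Ω → ℝ≥0) : l1Dist μ p q = l1Dist μ q p := by
  simp only [l1Dist_eq_lintegral, add_comm]

theorem l1Dist_congr {p p' q q' : Ω → ℝ≥0} (hp : p =ᵐ[μ] p') (hq : q =ᵐ[μ] q') :
    l1Dist μ p q = l1Dist μ p' q' := by
  simp only [l1Dist_eq_lintegral]
  refine lintegral_congr_ae ?_
  filter_upwards [hp, hq] with ω h₁ h₂
  rw [h₁, h₂]

theorem l1Dist_triangle {p q r : Ω → ℝ≥0} (hp : AEMeasurable p μ) (hq : AEMeasurable q μ)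
    (hr : AEMeasurable r μ) : l1Dist μ p r ≤ l1Dist μ p q + l1Dist μ q r := by
  have := eLpNorm_add_le (μ := μ) (p := 1) (f := fun ω => (p ω : ℝ) - q ω)
    (g := fun ω => (q ω : ℝ) - r ω)
    (hp.coe_nnreal_real.sub hq.coe_nnreal_real).aestronglyMeasurable
    (hq.coe_nnreal_real.sub hr.coe_nnreal_real).aestronglyMeasurable le_rfl
  refine le_of_eq_of_le ?_ this
  rw [l1Dist]
  congr 1
  ext ω
  simp

theorem lintegral_le_add_l1Dist {p q : Ω → ℝ≥0} (hp : AEMeasurable p μ) :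
    ∫⁻ ω, (q ω : ℝ≥0∞) ∂μ ≤ ∫⁻ ω, (p ω : ℝ≥0∞) ∂μ + l1Dist μ p q := by
  rw [l1Dist_eq_lintegral, ← lintegral_add_left' hp.coe_nnreal_ennreal]
  refine lintegral_mono fun ω => ?_
  rw [← ENNReal.coe_add, ENNReal.coe_le_coe]
  calc q ω ≤ p ω + (q ω - p ω) := le_add_tsub
    _ ≤ _ := by gcongr; exact le_add_self

/-- Between densities of equal mass, the `L¹` distance is twice the mass of the positive part. -/
theorem l1Dist_eq_two_mul {p q : Ω → ℝ≥0} (hp : AEMeasurable p μ) (hq : AEMeasurable q μ)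
    (hp1 : ∫⁻ ω, (p ω : ℝ≥0∞) ∂μ = 1) (hq1 : ∫⁻ ω, (q ω : ℝ≥0∞) ∂μ = 1) :
    l1Dist μ p q = 2 * ∫⁻ ω, ((q ω - p ω : ℝ≥0) : ℝ≥0∞) ∂μ := by
  have key : ∫⁻ ω, ((p ω - q ω : ℝ≥0) : ℝ≥0∞) ∂μ = ∫⁻ ω, ((q ω - p ω : ℝ≥0) : ℝ≥0∞) ∂μ := by
    refine (ENNReal.add_left_inj (a := 1) ENNReal.one_ne_top).1 ?_
    conv_lhs => rw [← hq1]
    conv_rhs => rw [← hp1]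
    rw [← lintegral_add_right' _ hp.coe_nnreal_ennreal,
      ← lintegral_add_right' _ hq.coe_nnreal_ennreal]
    refine lintegral_congr fun ω => ?_
    rw [← ENNReal.coe_add, ← ENNReal.coe_add, tsub_add_eq_max, tsub_add_eq_max, max_comm]
  have hm : AEMeasurable (fun ω => ((p ω - q ω : ℝ≥0) : ℝ≥0∞)) μ :=
    (hp.sub hq).coe_nnreal_ennreal
  rw [l1Dist_eq_lintegral]
  simp only [ENNReal.coe_add]
  rw [lintegral_add_left' hm, key, two_mul]

theorem exists_subseq_tendsto_ae {f : ℕ → Ω → ℝ≥0} {r : Ω → ℝ≥0}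
    (hf : ∀ k, AEMeasurable (f k) μ) (hr : AEMeasurable r μ)
    (h : Tendsto (fun k => l1Dist μ (f k) r) atTop (𝓝 0)) :
    ∃ ns : ℕ → ℕ, StrictMono ns ∧
      ∀ᵐ ω ∂μ, Tendsto (fun k => f (ns k) ω) atTop (𝓝 (r ω)) := by
  have h' : TendstoInMeasure μ (fun k ω => (f k ω : ℝ)) atTop (fun ω => (r ω : ℝ)) :=
    tendstoInMeasure_of_tendsto_eLpNorm one_ne_zero
      (fun k => (hf k).coe_nnreal_real.aestronglyMeasurable)
      hr.coe_nnreal_real.aestronglyMeasurable h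
  obtain ⟨ns, hns, hlim⟩ := h'.exists_seq_tendsto_ae
  exact ⟨ns, hns, hlim.mono fun ω hω => NNReal.tendsto_coe.1 hω⟩

theorem DensityBand.Mem.of_tendsto_l1Dist {B : DensityBand μ} {f : ℕ → Ω → ℝ≥0} {r : Ω → ℝ≥0}
    (hf : ∀ k, B.Mem (f k)) (hr : AEMeasurable r μ)
    (h : Tendsto (fun k => l1Dist μ (f k) r) atTop (𝓝 0)) : B.Mem r := by
  obtain ⟨ns, -, hlim⟩ := exists_subseq_tendsto_ae (fun k => (hf k).aemeasurable) hr h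
  refine ⟨hr, le_antisymm ?_ ?_, ?_, ?_⟩
  · have hl : Tendsto (fun k => 1 + l1Dist μ (f k) r) atTop (𝓝 (1 + 0)) :=
      tendsto_const_nhds.add h
    rw [add_zero] at hl
    refine ge_of_tendsto' hl fun k => ?_
    rw [← (hf k).lintegral_eq_one]
    exact lintegral_le_add_l1Dist (hf k).aemeasurable
  · have hl : Tendsto (fun k => ∫⁻ ω, (r ω : ℝ≥0∞) ∂μ + l1Dist μ (f k) r) atTop
        (𝓝 (∫⁻ ω, (r ω : ℝ≥0∞) ∂μ + 0)) := tendsto_const_nhds.add h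
    rw [add_zero] at hl
    refine ge_of_tendsto' hl fun k => ?_
    rw [← (hf k).lintegral_eq_one, l1Dist_comm]
    exact lintegral_le_add_l1Dist hr
  · filter_upwards [hlim, ae_all_iff.2 fun k => (hf k).lower_le] with ω h₁ h₂
    exact ge_of_tendsto' h₁ fun k => h₂ _
  · filter_upwards [hlim, ae_all_iff.2 fun k => (hf k).le_upper] with ω h₁ h₂
    exact le_of_tendsto' (ENNReal.tendsto_coe.2 h₁) fun k => h₂ _

end L1

/-! ### One half-step and the potentials `∫ max (q, t r)`. -/

section ClipStep

variable {Ω : Type*} [MeasurableSpace Ω] {μ : Measure Ω}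

/-- The optimality conditions that a step `q = clip d (α q' + r)` satisfies with respect to an
admissible density `q'`. -/
def IsClipStep (μ : Measure Ω) (α d : ℝ≥0) (q q' r : Ω → ℝ≥0) : Prop :=
  ∀ᵐ ω ∂μ, (q ω < q' ω → d * (α * q' ω + r ω) ≤ q ω) ∧
    (q' ω < q ω → q ω ≤ d * (α * q' ω + r ω))

theorem DensityBand.Mem.isClipStep {B : DensityBand μ} {α d : ℝ≥0} {q q' r : Ω → ℝ≥0}
    (hq' : B.Mem q') (hq : q =ᵐ[μ] B.clip d (fun ω => α * q' ω + r ω)) :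
    IsClipStep μ α d q q' r := by
  filter_upwards [hq, hq'.lower_le, hq'.le_upper] with ω h hl hu
  rw [h]
  exact ⟨fun hlt => DensityBand.mul_le_clip_of_lt hu hlt,
    fun hlt => DensityBand.clip_le_mul_of_lt hl hlt⟩

/-- A step decreases the mass of `max q (t r)`, for every `t`. -/
theorem IsClipStep.lintegral_max_le {α d : ℝ≥0} {q q' r : Ω → ℝ≥0}
    (h : IsClipStep μ α d q q' r) (hd : α * d ≤ 1)
    (hqm : AEMeasurable q μ) (hqm' : AEMeasurable q' μ)
    (hq : ∫⁻ ω, (q ω : ℝ≥0∞) ∂μ = 1) (hq' : ∫⁻ ω, (q' ω : ℝ≥0∞) ∂μ = 1) (t : ℝ≥0) :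
    ∫⁻ ω, (max (q ω) (t * r ω) : ℝ≥0) ∂μ ≤ ∫⁻ ω, (max (q' ω) (t * r ω) : ℝ≥0) ∂μ := by
  have hd' : (α : ℝ) * d ≤ 1 := by exact_mod_cast hd
  -- Compares the threshold `d / (1 - α d)` with `t`, division-free because `α d = 1` (infinite
  -- threshold) is allowed.
  rcases le_total ((d : ℝ)) (t * (1 - α * d)) with htd | htd
  · refine lintegral_mono_ae ?_
    filter_upwards [h] with ω hω
    rw [ENNReal.coe_le_coe]
    rcases le_or_gt (q ω) (q' ω) with hle | hlt
    · exact max_le_max_right _ hle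
    · refine (max_le ?_ le_rfl).trans (le_max_right _ _)
      have h1 := hω.2 hlt
      rw [← NNReal.coe_le_coe] at h1 ⊢
      rw [← NNReal.coe_lt_coe] at hlt
      push_cast at h1 ⊢
      have hpos : 0 < 1 - (α : ℝ) * d := by
        rcases hd'.lt_or_eq with h2 | h2
        · linarith
        · have : (d : ℝ) ≤ 0 := by rw [h2] at htd; linarith
          have : (d : ℝ) = 0 := le_antisymm this d.2
          rw [this] at h2; linarith
      have h3 : (α : ℝ) * d * q' ω ≤ α * d * q ω := by gcongr
      have h4 : (d : ℝ) * r ω ≤ t * (1 - α * d) * r ω := by gcongr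
      refine le_of_mul_le_mul_left ?_ hpos
      nlinarith
  -- Below the threshold it is `min (q, t r)` that grows pointwise; equality of the masses of `q`
  -- and `q'` converts this into a decrease of the maximum.
  · refine (ENNReal.add_le_add_iff_right (a := 1) ENNReal.one_ne_top).1 ?_
    conv_lhs => rw [← hq']
    conv_rhs => rw [← hq]
    rw [← lintegral_add_right' _ hqm'.coe_nnreal_ennreal,
      ← lintegral_add_right' _ hqm.coe_nnreal_ennreal]
    refine lintegral_mono_ae ?_
    filter_upwards [h] with ω hω
    rw [← ENNReal.coe_add, ← ENNReal.coe_add, ENNReal.coe_le_coe]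
    rcases le_or_gt (q' ω) (q ω) with hle | hlt
    · rcases le_total (q ω) (t * r ω) with h5 | h5
      · rw [max_eq_right h5, max_eq_right (hle.trans h5)]
        gcongr
      · rw [max_eq_left h5, add_comm]
        gcongr
        exact le_max_left _ _
    · have h1 := hω.1 hlt
      have h6 : t * r ω ≤ q ω := by
        rw [← NNReal.coe_le_coe] at h1 ⊢
        rw [← NNReal.coe_lt_coe] at hlt
        push_cast at h1 ⊢
        have hr : (0 : ℝ) ≤ d * r ω := by positivity
        have hpos : 0 < 1 - (α : ℝ) * d := by
          rcases hd'.lt_or_eq with h2 | h2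
          · linarith
          · have : (α : ℝ) * d * q' ω = q' ω := by rw [h2, one_mul]
            nlinarith
        have h3 : (α : ℝ) * d * q ω ≤ α * d * q' ω := by gcongr
        have h4 : t * (1 - α * d) * r ω ≤ (d : ℝ) * r ω := by gcongr
        refine le_of_mul_le_mul_left ?_ hpos
        nlinarith
      rw [max_eq_left h6, max_eq_left (h6.trans hlt.le), add_comm]

/-- For `t` beyond the effective threshold `s`, the decrease of the mass of `max q (t r)`
controls the step size. -/
theorem IsClipStep.lintegral_tsub_add_le {α d s t : ℝ≥0} {q q' r : Ω → ℝ≥0}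
    (h : IsClipStep μ α d q q' r) (hd : α * d < 1) (hs : s * (1 - α * d) = d) (hst : s ≤ t)
    (hqm : AEMeasurable q μ) (hrm : AEMeasurable r μ)
    (hr : ∫⁻ ω, (r ω : ℝ≥0∞) ∂μ = 1) :
    ∫⁻ ω, ((q' ω - q ω : ℝ≥0) : ℝ≥0∞) ∂μ + ∫⁻ ω, (max (q ω) (t * r ω) : ℝ≥0) ∂μ ≤
      ∫⁻ ω, (max (q' ω) (t * r ω) : ℝ≥0) ∂μ + (t - s : ℝ≥0) := by
  have hmax : AEMeasurable (fun ω => max (q ω) (t * r ω)) μ := hqm.max (hrm.const_mul t)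
  have hts : ((t - s : ℝ≥0) : ℝ≥0∞) = ∫⁻ ω, (((t - s) * r ω : ℝ≥0) : ℝ≥0∞) ∂μ := by
    simp only [ENNReal.coe_mul]
    rw [lintegral_const_mul'' _ hrm.coe_nnreal_ennreal, hr, mul_one]
  rw [hts, ← lintegral_add_right' _ hmax.coe_nnreal_ennreal,
    ← lintegral_add_right' _ (hrm.const_mul _).coe_nnreal_ennreal]
  refine lintegral_mono_ae ?_
  have hd' : 0 < 1 - (α : ℝ) * d := by
    have : (α : ℝ) * d < 1 := by exact_mod_cast hd
    linarith
  have hs' : (s : ℝ) * (1 - α * d) = d := by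
    have := congrArg NNReal.toReal hs
    rwa [NNReal.coe_mul, NNReal.coe_sub hd.le, NNReal.coe_one, NNReal.coe_mul] at this
  filter_upwards [h] with ω hω
  rw [← ENNReal.coe_add, ← ENNReal.coe_add, ENNReal.coe_le_coe]
  have htr : s * r ω ≤ t * r ω := by gcongr
  rcases lt_trichotomy (q ω) (q' ω) with hlt | heq | hlt
  · have h1 := hω.1 hlt
    have h6 : s * r ω ≤ q ω := by
      rw [← NNReal.coe_le_coe] at h1 ⊢
      rw [← NNReal.coe_lt_coe] at hlt
      push_cast at h1 ⊢
      have h3 : (α : ℝ) * d * q ω ≤ α * d * q' ω := by gcongr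
      refine le_of_mul_le_mul_left ?_ hd'
      nlinarith
    rw [← NNReal.coe_le_coe] at h6 htr ⊢
    push_cast [NNReal.coe_sub hlt.le, NNReal.coe_sub hst] at h6 htr ⊢
    rcases le_total (q ω : ℝ) (t * r ω) with h7 | h7
    · rw [max_eq_right h7]
      have := le_max_left (q' ω : ℝ) (t * r ω)
      nlinarith
    · rw [max_eq_left h7]
      have := le_max_left (q' ω : ℝ) (t * r ω)
      nlinarith
  · rw [heq, tsub_self, zero_add]
    exact le_self_add
  · rw [tsub_eq_zero_of_le hlt.le, zero_add]
    refine le_add_right ?_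
    refine (max_le ?_ le_rfl).trans (le_max_right _ _)
    refine le_trans ?_ htr
    have h1 := hω.2 hlt
    rw [← NNReal.coe_le_coe] at h1 ⊢
    rw [← NNReal.coe_lt_coe] at hlt
    push_cast at h1 ⊢
    have h3 : (α : ℝ) * d * q' ω ≤ α * d * q ω := by gcongr
    refine le_of_mul_le_mul_left ?_ hd'
    nlinarith

/-- If `α d` is close to one, the step is small. -/
theorem IsClipStep.lintegral_tsub_le {α d : ℝ≥0} {q q' r : Ω → ℝ≥0}
    (h : IsClipStep μ α d q q' r) (hqm' : AEMeasurable q' μ)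
    (hq' : ∫⁻ ω, (q' ω : ℝ≥0∞) ∂μ = 1) :
    ∫⁻ ω, ((q' ω - q ω : ℝ≥0) : ℝ≥0∞) ∂μ ≤ (1 - α * d : ℝ≥0) := by
  have hts : ((1 - α * d : ℝ≥0) : ℝ≥0∞) = ∫⁻ ω, (((1 - α * d) * q' ω : ℝ≥0) : ℝ≥0∞) ∂μ := by
    simp only [ENNReal.coe_mul (1 - α * d)]
    rw [lintegral_const_mul'' _ hqm'.coe_nnreal_ennreal, hq', mul_one]
  rw [hts]
  refine lintegral_mono_ae ?_
  filter_upwards [h] with ω hω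
  rw [ENNReal.coe_le_coe]
  rcases le_or_gt (q' ω) (q ω) with hle | hlt
  · simp [tsub_eq_zero_of_le hle]
  · rw [tsub_mul, one_mul]
    refine tsub_le_tsub_left (le_trans ?_ (hω.1 hlt)) _
    rw [mul_add, ← mul_assoc, mul_comm d α]
    exact le_self_add

end ClipStep

/-! ### Runs of the algorithm and bounded roots. -/

namespace IsAlgorithmRun

variable {Ω : Type*} [MeasurableSpace Ω] {μ : Measure Ω} {B₀ B₁ : DensityBand μ} {α : ℝ≥0}
  {q₀ q₁ : ℕ → Ω → ℝ≥0} {c₀ c₁ : ℕ → ℝ≥0}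

theorem mem (h : IsAlgorithmRun B₀ B₁ α q₀ q₁ c₀ c₁) (n : ℕ) : B₀.Mem (q₀ n) ∧ B₁.Mem (q₁ n) := by
  induction n with
  | zero => exact ⟨h.init₀, h.init₁⟩
  | succ n ih =>
    have h₀ : B₀.Mem (q₀ (n + 1)) := DensityBand.mem_of_ae_eq_clip
      ((ih.1.aemeasurable.const_mul α).add ih.2.aemeasurable)
      (DensityBand.lintegral_clip_of_g_eq_zero (h.root₀ n)) (h.step₀ n)
    exact ⟨h₀, DensityBand.mem_of_ae_eq_clip
      (h₀.aemeasurable.add (ih.2.aemeasurable.const_mul α))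
      (DensityBand.lintegral_clip_of_g_eq_zero (h.root₁ n)) (h.step₁ n)⟩

/-- The algorithm is symmetric: started half a pass later, it is a run for the swapped bands. -/
theorem swap (h : IsAlgorithmRun B₀ B₁ α q₀ q₁ c₀ c₁) :
    IsAlgorithmRun B₁ B₀ α q₁ (fun n => q₀ (n + 1)) c₁ (fun n => c₀ (n + 1)) where
  init₀ := h.init₁
  init₁ := (h.mem 1).1
  pos₀ := h.pos₁
  root₀ n := by simpa only [add_comm] using h.root₁ n
  step₀ n := by simpa only [add_comm] using h.step₁ n
  pos₁ n := h.pos₀ (n + 1)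
  root₁ n := by simpa only [add_comm (α * _)] using h.root₀ (n + 1)
  step₁ n := by simpa only [add_comm (α * _)] using h.step₀ (n + 1)

theorem aemeasurable_combination (h : IsAlgorithmRun B₀ B₁ α q₀ q₁ c₀ c₁) (n : ℕ) :
    AEMeasurable (fun ω => α * q₀ n ω + q₁ n ω) μ :=
  ((h.mem n).1.aemeasurable.const_mul α).add (h.mem n).2.aemeasurable

/-- Any density `f` below the clip at `M` certifies that this clip has mass at least one, so the
root can be capped at `M`. -/
theorem step_min (h : IsAlgorithmRun B₀ B₁ α q₀ q₁ c₀ c₁) {M : ℝ≥0} {n : ℕ} {f : Ω → ℝ≥0}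
    (hf : ∫⁻ ω, (f ω : ℝ≥0∞) ∂μ = 1)
    (hle : f ≤ᵐ[μ] B₀.clip M (fun ω => α * q₀ n ω + q₁ n ω)) :
    q₀ (n + 1) =ᵐ[μ] B₀.clip (min (c₀ n) M) (fun ω => α * q₀ n ω + q₁ n ω) := by
  refine (h.step₀ n).trans (DensityBand.clip_min_ae_eq (h.aemeasurable_combination n)
    (DensityBand.lintegral_clip_of_g_eq_zero (h.root₀ n)) ?_)
  rw [← hf]
  exact lintegral_mono_ae (hle.mono fun ω hω => ENNReal.coe_le_coe.2 hω)

/-- Without the damping term, the roots for the second band are bounded below by its free mass. -/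
theorem one_le_root_add_lintegral_lower (h : IsAlgorithmRun B₀ B₁ 0 q₀ q₁ c₀ c₁) (n : ℕ) :
    1 ≤ c₁ n + ∫⁻ ω, (B₁.lower ω : ℝ≥0∞) ∂μ := by
  have hm := (h.mem (n + 1)).1
  calc (1 : ℝ≥0∞) = ∫⁻ ω, (q₁ (n + 1) ω : ℝ≥0∞) ∂μ := (h.mem (n + 1)).2.lintegral_eq_one.symm
    _ ≤ ∫⁻ ω, (c₁ n * (q₀ (n + 1) ω : ℝ≥0∞) + B₁.lower ω) ∂μ := by
      refine lintegral_mono_ae ((h.step₁ n).mono fun ω hω => ?_)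
      rw [hω, ← ENNReal.coe_mul, ← ENNReal.coe_add, ENNReal.coe_le_coe]
      refine (B₁.clip_le_max _ _ _).trans (max_le ?_ le_add_self)
      simp
    _ = _ := by
      rw [lintegral_add_right _ B₁.measurable_lower.coe_nnreal_ennreal,
        lintegral_const_mul'' _ hm.aemeasurable.coe_nnreal_ennreal, hm.lintegral_eq_one, mul_one]

theorem exists_bound_of_eq_zero (h : IsAlgorithmRun B₀ B₁ 0 q₀ q₁ c₀ c₁) :
    ∃ M : ℝ≥0, 0 < M ∧ ∀ n, q₀ (n + 1) =ᵐ[μ] B₀.clip (min (c₀ n) M)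
      (fun ω => 0 * q₀ n ω + q₁ n ω) := by
  -- If the lower bound has mass one, the roots `c₁` need not stay away from zero, but then `q₁` is
  -- pinned to it.
  obtain ⟨K, hK⟩ : ∃ K : ℝ≥0, ∀ n, 1 ≤ K * c₁ n ∨ q₁ (n + 1) =ᵐ[μ] q₁ n := by
    set m := ∫⁻ ω, (B₁.lower ω : ℝ≥0∞) ∂μ with hm
    have hm1 : m ≤ 1 := B₁.lintegral_lower_le
    rcases hm1.lt_or_eq with hlt | heq
    · lift m to ℝ≥0 using ne_top_of_lt hlt with m'
      have hlt' : m' < 1 := by exact_mod_cast hlt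
      refine ⟨(1 - m')⁻¹, fun n => .inl ?_⟩
      have h1 := h.one_le_root_add_lintegral_lower n
      rw [← hm] at h1
      have h2 : 1 ≤ c₁ n + m' := by exact_mod_cast h1
      have h3 : 0 < 1 - m' := tsub_pos_of_lt hlt'
      calc (1 : ℝ≥0) = (1 - m')⁻¹ * (1 - m') := (inv_mul_cancel₀ h3.ne').symm
        _ ≤ _ := by gcongr; exact tsub_le_iff_right.2 h2
    · refine ⟨0, fun n => .inr ?_⟩
      have key : ∀ k, B₁.lower =ᵐ[μ] q₁ k := fun k =>
        DensityBand.ae_eq_of_le_of_lintegral_eq_one heq (h.mem k).2.aemeasurable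
          (h.mem k).2.lower_le (h.mem k).2.lintegral_eq_one.le
      exact (key (n + 1)).symm.trans (key n)
  -- `c₀ 0` serves the base case and `K` the induction: where `q₁` falls, its new value is at least
  -- `c₁ n * q₀ (n + 1)`, hence `q₀ (n + 1) ≤ K q₁ (n + 1)`.
  have hpos : 0 < max (c₀ 0) K := lt_max_of_lt_left (h.pos₀ 0)
  have hbound : ∀ n, q₀ (n + 1) ≤ᵐ[μ]
      B₀.clip (max (c₀ 0) K) (fun ω => 0 * q₀ n ω + q₁ n ω) := by
    intro n
    induction n with
    | zero =>
      filter_upwards [h.step₀ 0] with ω hω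
      rw [hω]
      exact B₀.clip_mono (mul_le_mul_left (le_max_left _ _) _)
    | succ n ih =>
      suffices hq : q₀ (n + 1) ≤ᵐ[μ]
          B₀.clip (max (c₀ 0) K) (fun ω => 0 * q₀ (n + 1) ω + q₁ (n + 1) ω) by
        filter_upwards [h.step_min (h.mem (n + 1)).1.lintegral_eq_one hq] with ω hω
        rw [hω]
        exact B₀.clip_mono (mul_le_mul_left (min_le_right _ _) _)
      rcases hK n with hKn | hKn
      · filter_upwards [ih, h.step₁ n, (h.mem n).2.le_upper, (h.mem (n + 1)).1.le_upper]
          with ω h1 h2 h3 h4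
        refine DensityBand.le_clip h4 ?_
        simp only [zero_mul, zero_add, add_zero] at h1 h2 ⊢
        rcases le_or_gt (q₁ n ω) (q₁ (n + 1) ω) with hle | hlt
        · exact (h1.trans (B₀.clip_le_max _ _ _)).trans (max_le_max_right _ (by gcongr))
        · have h5 : c₁ n * q₀ (n + 1) ω ≤ q₁ (n + 1) ω := by
            rw [h2] at hlt ⊢
            exact DensityBand.mul_le_clip_of_lt h3 hlt
          refine le_max_of_le_left ?_
          calc q₀ (n + 1) ω ≤ K * c₁ n * q₀ (n + 1) ω := le_mul_of_one_le_left' hKn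
            _ = K * (c₁ n * q₀ (n + 1) ω) := mul_assoc _ _ _
            _ ≤ _ := by gcongr; exact le_max_right _ _
      · filter_upwards [ih, hKn] with ω h1 h2
        refine h1.trans (B₀.clip_mono ?_)
        simp only [zero_mul, zero_add, h2, le_refl]
  exact ⟨_, hpos, fun n => h.step_min (h.mem (n + 1)).1.lintegral_eq_one (hbound n)⟩

/-- The roots may be replaced by uniformly bounded ones, at most `1 / α`. -/
theorem exists_bound (h : IsAlgorithmRun B₀ B₁ α q₀ q₁ c₀ c₁) :
    ∃ M : ℝ≥0, 0 < M ∧ α * M ≤ 1 ∧ ∀ n, q₀ (n + 1) =ᵐ[μ] B₀.clip (min (c₀ n) M)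
      (fun ω => α * q₀ n ω + q₁ n ω) := by
  rcases eq_zero_or_pos α with rfl | hα
  · obtain ⟨M, hM, hM'⟩ := h.exists_bound_of_eq_zero
    exact ⟨M, hM, by simp, hM'⟩
  · refine ⟨α⁻¹, inv_pos.2 hα, (mul_inv_cancel₀ hα.ne').le, fun n => ?_⟩
    refine h.step_min (h.mem n).1.lintegral_eq_one ?_
    filter_upwards [(h.mem n).1.le_upper] with ω hω
    refine DensityBand.le_clip hω (le_max_of_le_left ?_)
    rw [mul_add, inv_mul_cancel_left₀ hα.ne']
    exact le_self_add

theorem exists_isClipStep (h : IsAlgorithmRun B₀ B₁ α q₀ q₁ c₀ c₁) :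
    ∃ M : ℝ≥0, ∀ n, ∃ d ≤ M, α * d ≤ 1 ∧ IsClipStep μ α d (q₀ (n + 1)) (q₀ n) (q₁ n) := by
  obtain ⟨M, -, hM, hstep⟩ := h.exists_bound
  refine ⟨M, fun n => ⟨min (c₀ n) M, min_le_right _ _, le_trans ?_ hM,
    (h.mem n).1.isClipStep (hstep n)⟩⟩
  gcongr
  exact min_le_right _ _

/-! ### Decrease of the potentials and vanishing steps. -/

theorem lintegral_max_le_step₀ (h : IsAlgorithmRun B₀ B₁ α q₀ q₁ c₀ c₁) (t : ℝ≥0) (n : ℕ) :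
    ∫⁻ ω, (max (q₀ (n + 1) ω) (t * q₁ n ω) : ℝ≥0) ∂μ ≤
      ∫⁻ ω, (max (q₀ n ω) (t * q₁ n ω) : ℝ≥0) ∂μ := by
  obtain ⟨M, hM⟩ := h.exists_isClipStep
  obtain ⟨d, -, hd, hstep⟩ := hM n
  exact hstep.lintegral_max_le hd (h.mem (n + 1)).1.aemeasurable (h.mem n).1.aemeasurable
    (h.mem (n + 1)).1.lintegral_eq_one (h.mem n).1.lintegral_eq_one t

/-- By homogeneity `max (x, t y) = t max (y, t⁻¹ x)`, so both half-steps share the same potentials.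
-/
theorem lintegral_max_le_step₁ (h : IsAlgorithmRun B₀ B₁ α q₀ q₁ c₀ c₁) (t : ℝ≥0) (n : ℕ) :
    ∫⁻ ω, (max (q₀ (n + 1) ω) (t * q₁ (n + 1) ω) : ℝ≥0) ∂μ ≤
      ∫⁻ ω, (max (q₀ (n + 1) ω) (t * q₁ n ω) : ℝ≥0) ∂μ := by
  rcases eq_zero_or_pos t with rfl | ht
  · simp
  · have key : ∀ x y : ℝ≥0, ((max x (t * y) : ℝ≥0) : ℝ≥0∞) =
        t * ((max y (t⁻¹ * x) : ℝ≥0) : ℝ≥0∞) := by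
      intro x y
      rw [← ENNReal.coe_mul, mul_max, mul_inv_cancel_left₀ ht.ne', max_comm]
    simp only [key]
    rw [lintegral_const_mul' _ _ ENNReal.coe_ne_top, lintegral_const_mul' _ _ ENNReal.coe_ne_top]
    exact mul_le_mul' le_rfl (h.swap.lintegral_max_le_step₀ t⁻¹ n)

theorem lintegral_max_ne_top (h : IsAlgorithmRun B₀ B₁ α q₀ q₁ c₀ c₁) (t : ℝ≥0) (n : ℕ) :
    ∫⁻ ω, (max (q₀ n ω) (t * q₁ n ω) : ℝ≥0) ∂μ ≠ ∞ := by
  have hm := h.mem n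
  refine ne_top_of_le_ne_top (b := 1 + t * 1)
    (ENNReal.add_ne_top.2 ⟨ENNReal.one_ne_top, by simp⟩) ?_
  conv_rhs => rw [← hm.1.lintegral_eq_one]
  conv_rhs =>
    enter [2, 2]
    rw [hm.1.lintegral_eq_one, ← hm.2.lintegral_eq_one]
  rw [← lintegral_const_mul'' _ hm.2.aemeasurable.coe_nnreal_ennreal,
    ← lintegral_add_left' hm.1.aemeasurable.coe_nnreal_ennreal]
  refine lintegral_mono fun ω => ?_
  rw [← ENNReal.coe_mul, ← ENNReal.coe_add, ENNReal.coe_le_coe]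
  exact max_le le_self_add le_add_self

theorem tendsto_lintegral_max_sub (h : IsAlgorithmRun B₀ B₁ α q₀ q₁ c₀ c₁) (t : ℝ≥0) :
    Tendsto (fun n => ∫⁻ ω, (max (q₀ n ω) (t * q₁ n ω) : ℝ≥0) ∂μ -
      ∫⁻ ω, (max (q₀ (n + 1) ω) (t * q₁ (n + 1) ω) : ℝ≥0) ∂μ) atTop (𝓝 0) := by
  set a : ℕ → ℝ≥0∞ := fun n => ∫⁻ ω, (max (q₀ n ω) (t * q₁ n ω) : ℝ≥0) ∂μ
  have hanti : Antitone a := antitone_nat_of_succ_le fun n =>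
    (h.lintegral_max_le_step₁ t n).trans (h.lintegral_max_le_step₀ t n)
  have hlim := tendsto_atTop_iInf hanti
  have hfin : ⨅ n, a n ≠ ∞ := ne_top_of_le_ne_top (h.lintegral_max_ne_top t 0) (iInf_le a 0)
  have := ENNReal.Tendsto.sub hlim (hlim.comp (tendsto_add_atTop_nat 1)) (.inl hfin)
  rwa [tsub_self] at this

theorem tendsto_lintegral_tsub (h : IsAlgorithmRun B₀ B₁ α q₀ q₁ c₀ c₁) :
    Tendsto (fun n => ∫⁻ ω, ((q₀ n ω - q₀ (n + 1) ω : ℝ≥0) : ℝ≥0∞) ∂μ) atTop (𝓝 0) := by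
  obtain ⟨M, hM⟩ := h.exists_isClipStep
  rw [ENNReal.tendsto_nhds_zero]
  intro ε hε
  obtain ⟨η, hη, hηε⟩ := ENNReal.lt_iff_exists_nnreal_btwn.1 hε
  obtain ⟨δ, hδ, rfl⟩ : ∃ δ : ℝ≥0, 0 < δ ∧ η = δ + δ :=
    ⟨η / 2, half_pos (by exact_mod_cast hη), (add_halves η).symm⟩
  -- When `1 - α d > δ`, the threshold is at most `M / δ`; a grid of mesh `δ` up to there is finite,
  -- so all its potentials drop by at most `δ` eventually.
  have hgrid : ∀ᶠ n in atTop, ∀ j ∈ Finset.range (⌈M / δ / δ⌉₊ + 1),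
      ∫⁻ ω, (max (q₀ n ω) ((j * δ : ℝ≥0) * q₁ n ω) : ℝ≥0) ∂μ -
        ∫⁻ ω, (max (q₀ (n + 1) ω) ((j * δ : ℝ≥0) * q₁ (n + 1) ω) : ℝ≥0) ∂μ ≤ δ := by
    rw [eventually_all_finset]
    intro j _
    exact ENNReal.tendsto_nhds_zero.1 (h.tendsto_lintegral_max_sub (j * δ)) δ (by simpa using hδ)
  filter_upwards [hgrid] with n hn
  refine le_trans ?_ hηε.le
  obtain ⟨d, hdM, -, hstep⟩ := hM n
  have hm := h.mem n
  rcases le_or_gt (1 - α * d) δ with hle | hlt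
  · refine (hstep.lintegral_tsub_le hm.1.aemeasurable hm.1.lintegral_eq_one).trans ?_
    exact ENNReal.coe_le_coe.2 (hle.trans le_self_add)
  · have hw : 0 < 1 - α * d := hδ.trans hlt
    set s := d / (1 - α * d) with hs
    have hsM : s ≤ M / δ := div_le_div₀ zero_le hdM hδ hlt.le
    have hj : ⌈s / δ⌉₊ ∈ Finset.range (⌈M / δ / δ⌉₊ + 1) := by
      rw [Finset.mem_range, Nat.lt_succ_iff]
      gcongr
    have hst : s ≤ ⌈s / δ⌉₊ * δ := (div_le_iff₀ hδ).1 (Nat.le_ceil _)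
    have hts : (⌈s / δ⌉₊ * δ : ℝ≥0) - s ≤ δ := by
      rw [tsub_le_iff_left]
      calc (⌈s / δ⌉₊ * δ : ℝ≥0) ≤ (s / δ + 1) * δ := by
            gcongr
            exact (Nat.ceil_lt_add_one zero_le).le
        _ = s + δ := by rw [add_mul, div_mul_cancel₀ _ hδ.ne', one_mul]
    have hmain := hstep.lintegral_tsub_add_le (tsub_pos_iff_lt.1 hw) (div_mul_cancel₀ _ hw.ne') hst
      (h.mem (n + 1)).1.aemeasurable hm.2.aemeasurable hm.2.lintegral_eq_one
    have hfin := h.lintegral_max_ne_top (⌈s / δ⌉₊ * δ) (n + 1)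
    have h1 := (add_le_add_right (h.lintegral_max_le_step₁ (⌈s / δ⌉₊ * δ) n) _).trans hmain
    have h2 := tsub_le_iff_left.1 (hn _ hj)
    refine (ENNReal.add_le_add_iff_right hfin).1 (h1.trans ?_)
    refine (add_le_add h2 (ENNReal.coe_le_coe.2 hts)).trans (le_of_eq ?_)
    rw [ENNReal.coe_add]
    ring

/-- Successive iterates merge. -/
theorem tendsto_l1Dist_succ (h : IsAlgorithmRun B₀ B₁ α q₀ q₁ c₀ c₁) :
    Tendsto (fun n => l1Dist μ (q₀ (n + 1)) (q₀ n)) atTop (𝓝 0) := by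
  have hlim := ENNReal.Tendsto.const_mul (a := 2) h.tendsto_lintegral_tsub (.inr (by simp))
  rw [mul_zero] at hlim
  refine hlim.congr fun n => ?_
  exact (l1Dist_eq_two_mul (h.mem (n + 1)).1.aemeasurable (h.mem n).1.aemeasurable
    (h.mem (n + 1)).1.lintegral_eq_one (h.mem n).1.lintegral_eq_one).symm

/-! ### Asymptotic equations and limit points. -/

theorem l1Dist_clip_le {B : DensityBand μ} {d : ℝ≥0} (hd : α * d ≤ 1) (p r r' : Ω → ℝ≥0) :
    l1Dist μ (B.clip d (fun ω => p ω + α * r ω)) (B.clip d (fun ω => p ω + α * r' ω)) ≤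
      l1Dist μ r r' := by
  have key : ∀ (f g : Ω → ℝ≥0) ω, B.clip d (fun ω => p ω + α * f ω) ω -
      B.clip d (fun ω => p ω + α * g ω) ω ≤ f ω - g ω := by
    intro f g ω
    refine (B.clip_tsub_clip_le d d _ _ ω).trans ?_
    rw [mul_add, mul_add, add_tsub_add_eq_tsub_left, ← mul_assoc, ← mul_assoc, ← mul_tsub,
      mul_comm d α]
    exact mul_le_of_le_one_left' hd
  simp only [l1Dist_eq_lintegral]
  exact lintegral_mono fun ω => ENNReal.coe_le_coe.2 (add_le_add (key r r' ω) (key r' r ω))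

/-- The first iterates satisfy the first implicit equation asymptotically. -/
theorem exists_tendsto_l1Dist_clip₀ (h : IsAlgorithmRun B₀ B₁ α q₀ q₁ c₀ c₁) :
    ∃ d : ℕ → ℝ≥0, (∀ n, 0 < d n ∧ α * d n ≤ 1) ∧
      Tendsto (fun n => l1Dist μ (q₀ n)
        (B₀.clip (d n) (fun ω => α * q₀ n ω + q₁ n ω))) atTop (𝓝 0) := by
  obtain ⟨M, hM, hαM, hstep⟩ := h.exists_bound
  refine ⟨fun n => min (c₀ n) M, fun n => ⟨lt_min (h.pos₀ n) hM, le_trans ?_ hαM⟩, ?_⟩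
  · gcongr
    exact min_le_right _ _
  · refine h.tendsto_l1Dist_succ.congr fun n => ?_
    rw [l1Dist_comm]
    exact l1Dist_congr (ae_eq_refl _) (hstep n)

/-- The second iterates satisfy the second implicit equation asymptotically. -/
theorem exists_tendsto_l1Dist_clip₁ (h : IsAlgorithmRun B₀ B₁ α q₀ q₁ c₀ c₁) :
    ∃ d : ℕ → ℝ≥0, (∀ n, 0 < d n ∧ α * d n ≤ 1) ∧
      Tendsto (fun n => l1Dist μ (q₁ n)
        (B₁.clip (d n) (fun ω => q₀ n ω + α * q₁ n ω))) atTop (𝓝 0) := by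
  obtain ⟨M, hM, hαM, hstep⟩ := h.swap.exists_bound
  have hd : ∀ n, α * min (c₁ n) M ≤ 1 := fun n =>
    le_trans (by gcongr; exact min_le_right _ _) hαM
  -- The root that produced `q₁ n` has index `n - 1`; the truncated value at `n = 0` does not affect
  -- the limit.
  refine ⟨fun n => min (c₁ (n - 1)) M, fun n => ⟨lt_min (h.pos₁ _) hM, hd _⟩, ?_⟩
  rw [← tendsto_add_atTop_iff_nat 1]
  simp only [Nat.add_sub_cancel]
  refine tendsto_of_tendsto_of_tendsto_of_le_of_le tendsto_const_nhds h.swap.tendsto_l1Dist_succ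
    (fun _ => zero_le) fun n => ?_
  have hn : q₁ (n + 1) =ᵐ[μ] B₁.clip (min (c₁ n) M) (fun ω => q₀ (n + 1) ω + α * q₁ n ω) := by
    simpa only [add_comm] using hstep n
  rw [l1Dist_congr hn (ae_eq_refl _)]
  exact (l1Dist_clip_le (hd n) _ _ _).trans_eq (l1Dist_comm _ _)

theorem tendsto_l1Dist_succ_comp (h : IsAlgorithmRun B₀ B₁ α q₀ q₁ c₀ c₁) {φ : ℕ → ℕ}
    {r : Ω → ℝ≥0} (hφ : StrictMono φ) (hr : AEMeasurable r μ)
    (hlim : Tendsto (fun k => l1Dist μ (q₀ (φ k)) r) atTop (𝓝 0)) :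
    Tendsto (fun k => l1Dist μ (q₀ (φ k + 1)) r) atTop (𝓝 0) := by
  have hsum := (h.tendsto_l1Dist_succ.comp hφ.tendsto_atTop).add hlim
  rw [add_zero] at hsum
  exact tendsto_of_tendsto_of_tendsto_of_le_of_le tendsto_const_nhds hsum
    (fun _ => zero_le) fun k => l1Dist_triangle (h.mem _).1.aemeasurable
      (h.mem _).1.aemeasurable hr

/-- Limit points of the iterates solve the first implicit equation. -/
theorem exists_eq_clip_of_tendsto (h : IsAlgorithmRun B₀ B₁ α q₀ q₁ c₀ c₁) {φ : ℕ → ℕ}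
    {r₀ r₁ : Ω → ℝ≥0} (hφ : StrictMono φ) (hr₀ : AEMeasurable r₀ μ) (hr₁ : AEMeasurable r₁ μ)
    (h₀ : Tendsto (fun k => l1Dist μ (q₀ (φ k)) r₀) atTop (𝓝 0))
    (h₁ : Tendsto (fun k => l1Dist μ (q₁ (φ k)) r₁) atTop (𝓝 0)) :
    ∃ e : ℝ≥0, α * e ≤ 1 ∧ (∫⁻ ω, (B₀.lower ω : ℝ≥0∞) ∂μ < 1 → 0 < e) ∧
      r₀ =ᵐ[μ] B₀.clip e (fun ω => α * r₀ ω + r₁ ω) := by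
  obtain ⟨M, -, hαM, hstep⟩ := h.exists_bound
  obtain ⟨n₁, hn₁, hae₁⟩ := exists_subseq_tendsto_ae (fun k => (h.mem (φ k)).1.aemeasurable) hr₀ h₀
  obtain ⟨n₂, hn₂, hae₂⟩ := exists_subseq_tendsto_ae
    (fun k => (h.mem (φ (n₁ k))).2.aemeasurable) hr₁ (h₁.comp hn₁.tendsto_atTop)
  -- The left side of the update is the next iterate, which has the same limit because steps vanish.
  obtain ⟨n₃, hn₃, hae₃⟩ := exists_subseq_tendsto_ae
    (fun k => (h.mem (φ (n₁ (n₂ k)) + 1)).1.aemeasurable) hr₀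
    ((h.tendsto_l1Dist_succ_comp hφ hr₀ h₀).comp (hn₁.comp hn₂).tendsto_atTop)
  obtain ⟨e, he, n₄, hn₄, hlim⟩ := (isCompact_Icc (a := (0 : ℝ≥0)) (b := M)).tendsto_subseq
    (x := fun k => min (c₀ (φ (n₁ (n₂ (n₃ k))))) M) fun k => ⟨zero_le, min_le_right _ _⟩
  have hr : r₀ =ᵐ[μ] B₀.clip e (fun ω => α * r₀ ω + r₁ ω) := by
    filter_upwards [hae₁, hae₂, hae₃, ae_all_iff.2 hstep] with ω a₁ a₂ a₃ a₄
    have b₁ := a₁.comp (hn₂.comp (hn₃.comp hn₄)).tendsto_atTop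
    have b₂ := a₂.comp (hn₃.comp hn₄).tendsto_atTop
    have b₃ := a₃.comp hn₄.tendsto_atTop
    refine tendsto_nhds_unique b₃ ?_
    refine (B₀.tendsto_clip hlim (p := fun k ω => α * q₀ (φ (n₁ (n₂ (n₃ (n₄ k))))) ω +
      q₁ (φ (n₁ (n₂ (n₃ (n₄ k))))) ω) (p' := fun ω => α * r₀ ω + r₁ ω) (ω := ω)
      ((b₁.const_mul α).add b₂)).congr fun k => ?_
    exact (a₄ _).symm
  refine ⟨e, le_trans (by gcongr; exact he.2) hαM, fun hlt => pos_iff_ne_zero.2 ?_, hr⟩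
  -- A limit constant zero would make `r₀` the lower bound, which would then have mass one.
  rintro rfl
  have hmem := DensityBand.Mem.of_tendsto_l1Dist (fun k => (h.mem (φ k)).1) hr₀ h₀
  refine hlt.ne ?_
  rw [← hmem.lintegral_eq_one]
  refine lintegral_congr_ae (hr.mono fun ω hω => ?_)
  simp only [hω, DensityBand.clip_zero]

end IsAlgorithmRun

theorem mainTheorem4 {Ω : Type*} [MeasurableSpace Ω] (μ : Measure Ω)
    (B₀ B₁ : DensityBand μ) (α : ℝ≥0)
    (q₀ q₁ : ℕ → Ω → ℝ≥0) (c₀ c₁ : ℕ → ℝ≥0)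
    (hrun : IsAlgorithmRun B₀ B₁ α q₀ q₁ c₀ c₁) :
    -- successive iterates merge
    (Tendsto (fun n => l1Dist μ (q₀ (n + 1)) (q₀ n)) atTop (𝓝 0) ∧
      Tendsto (fun n => l1Dist μ (q₁ (n + 1)) (q₁ n)) atTop (𝓝 0)) ∧
    -- the iterates satisfy the implicit equations asymptotically, with admissible constants
    (∃ d₀ d₁ : ℕ → ℝ≥0,
      (∀ n, 0 < d₀ n ∧ α * d₀ n ≤ 1 ∧ 0 < d₁ n ∧ α * d₁ n ≤ 1) ∧
      Tendsto (fun n => l1Dist μ (q₀ n)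
        (B₀.clip (d₀ n) (fun ω => α * q₀ n ω + q₁ n ω))) atTop (𝓝 0) ∧
      Tendsto (fun n => l1Dist μ (q₁ n)
        (B₁.clip (d₁ n) (fun ω => q₀ n ω + α * q₁ n ω))) atTop (𝓝 0)) ∧
    -- every limit point of the iterates is an exact solution in the two bands
    (∀ (φ : ℕ → ℕ) (r₀ r₁ : Ω → ℝ≥0), StrictMono φ → AEMeasurable r₀ μ → AEMeasurable r₁ μ →
      Tendsto (fun k => l1Dist μ (q₀ (φ k)) r₀) atTop (𝓝 0) →
      Tendsto (fun k => l1Dist μ (q₁ (φ k)) r₁) atTop (𝓝 0) →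
      B₀.Mem r₀ ∧ B₁.Mem r₁ ∧
      ∃ e₀ e₁ : ℝ≥0, α * e₀ ≤ 1 ∧ α * e₁ ≤ 1 ∧
        (∫⁻ ω, (B₀.lower ω : ℝ≥0∞) ∂μ < 1 → 0 < e₀) ∧
        (∫⁻ ω, (B₁.lower ω : ℝ≥0∞) ∂μ < 1 → 0 < e₁) ∧
        SolvesImplicitEquations B₀ B₁ α e₀ e₁ r₀ r₁) := by
  refine ⟨⟨hrun.tendsto_l1Dist_succ, hrun.swap.tendsto_l1Dist_succ⟩, ?_, ?_⟩
  · obtain ⟨d₀, hd₀, h₀⟩ := hrun.exists_tendsto_l1Dist_clip₀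
    obtain ⟨d₁, hd₁, h₁⟩ := hrun.exists_tendsto_l1Dist_clip₁
    exact ⟨d₀, d₁, fun n => ⟨(hd₀ n).1, (hd₀ n).2, (hd₁ n).1, (hd₁ n).2⟩, h₀, h₁⟩
  · intro φ r₀ r₁ hφ hr₀ hr₁ h₀ h₁
    obtain ⟨e₀, he₀, hpos₀, heq₀⟩ := hrun.exists_eq_clip_of_tendsto hφ hr₀ hr₁ h₀ h₁
    -- The swapped run pairs `q₁ n` with `q₀ (n + 1)`, so the limit `r₀` is needed along the shifted
    -- indices.
    obtain ⟨e₁, he₁, hpos₁, heq₁⟩ := hrun.swap.exists_eq_clip_of_tendsto hφ hr₁ hr₀ h₁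
      (hrun.tendsto_l1Dist_succ_comp hφ hr₀ h₀)
    refine ⟨.of_tendsto_l1Dist (fun k => (hrun.mem (φ k)).1) hr₀ h₀,
      .of_tendsto_l1Dist (fun k => (hrun.mem (φ k)).2) hr₁ h₁,
      e₀, e₁, he₀, he₁, hpos₀, hpos₁, heq₀, ?_⟩
    simpa only [add_comm] using heq₁
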